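/- Let $\kappa$ be a nonempty index set (e.g. an infinite cardinal), $I^*$ a proper ideal on $\kappa$, $\bar\lambda=\langle\lambda_i : i<\kappa\rangle$ a sequence of (infinite) regular cardinals, and $\theta$ a cardinal. For an ideal $I$ on $\kappa$ put $\liminf_I\bar\lambda=\min\{\mu : \{i<\kappa : \lambda_i\le\mu\}\notin I\}$, and let $\mathrm{wsat}(I)$ be the least nonzero cardinal $\sigma$ such that $\kappa$ cannot be partitioned into $\sigma$ pairwise disjoint sets not in $I$. Assume $(*)$ either $\lambda_i>\theta$ for all $i<\kappa$ and $\theta\ge\mathrm{wsat}(I^*)$, or $\liminf_{I^*}\bar\lambda\ge\theta\ge\mathrm{wsat}(I^*)$ and $\prod\bar\lambda/I^*$ is $\theta^+$-directed (every set of at most $\theta$ functions in $\prod_{i<\kappa}\lambda_i$ has an upper bound with respect to $\le$ modulo $I^*$). For an ultrafilter $D$ on $\kappa$ let $\mathrm{tcf}(\prod\bar\lambda/D)$ be the true cofinality of the linear order $\prod\bar\lambda/D$, i.e. the least cardinal $\mu$ for which there is a strictly increasing cofinal sequence of length $\mu$. Let $$\mathrm{pcf}_I(\bar\lambda)=\{\mathrm{tcf}(\textstyle\prod\bar\lambda/D)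 : D\text{ an ultrafilter on }\kappa,\ D\cap I=\emptyset\},$$ $\mathrm{pcf}(\bar\lambda)=\mathrm{pcf}_{I^*}(\bar\lambda)$, and for $B\subseteq\kappa$ let $\mathrm{pcf}(\bar\lambda\restriction B)=\mathrm{pcf}_{I^*+(\kappa\setminus B)}(\bar\lambda)$ (which is $\emptyset$ if $B\in I^*$). Here $J+A$ denotes the ideal generated by the ideal $J$ and the set $A$. For a cardinal $\lambda$ let $J_{<\lambda}[\bar\lambda]$ be the ideal of all $B\subseteq\kappa$ such that no ultrafilter $D$ on $\kappa$ with $D\cap I^*=\emptyset$ and $B\in D$ satisfies $\mathrm{tcf}(\prod\bar\lambda/D)\ge\lambda$, and let $J_{\le\lambda}[\bar\lambda]=J_{<\lambda^+}[\bar\lambda]$. A family $\langle B_\lambda : \lambda\in\mathfrak c\rangle$ of subsets of $\kappa$ is a generating sequence for $\bar\lambda$ if $\mathfrak c\subseteq\mathrm{pcf}(\bar\lambda)$ and $J_{\le\lambda}[\bar\lambda]=J_{<\lambda}[\bar\lambda]+B_\lambda$ for every $\lambda\in\mathfrak c$. (1) If $\langle B_\lambda : \lambda\in\mathfrak c\rangle$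 is a generating sequence for $\bar\lambda$, $B\subseteq\kappa$ and $\mathrm{pcf}(\bar\lambda\restriction B)\subseteq\mathfrak c$, then there is a finite $\mathfrak d\subseteq\mathfrak c$ such that $B\setminus\bigcup_{\mu\in\mathfrak d}B_\mu\in I^*$. (2) $\mathrm{cf}(\prod\bar\lambda/I^*)=\max\mathrm{pcf}(\bar\lambda)$: the set $\mathrm{pcf}(\bar\lambda)$ has a greatest element, and it is the least cardinality of a set cofinal in $\prod_{i<\kappa}\lambda_i$ with respect to $\le$ modulo $I^*$. -/

import Mathlib

open Cardinal Order

universe u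

namespace PcfTheory

/-! ### Quasi-orders: directedness, cofinality, true cofinality -/

/-- `P` is `μ`-directed: every subset of `P` of cardinality `< μ` has an upper bound in `P`. -/
def IsCardDirected (P : Type u) [Preorder P] (μ : Cardinal.{u}) : Prop :=
  ∀ A : Set P, #A < μ → ∃ q : P, ∀ p ∈ A, p ≤ q

/-- `P` has a strictly increasing sequence of length `μ` that is cofinal in `P`. -/
def HasTrueCofinality (P : Type u) [Preorder P] (μ : Cardinal.{u}) : Prop :=
  ∃ p : μ.ord.ToType → P, (∀ a b, a < b → p a < p b) ∧ ∀ q : P, ∃ a, q ≤ p a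

/-- `tcf P`: the least `μ` such that `P` has true cofinality `μ`.  (It exists for linear
quasi-orders, such as products modulo ultrafilters, which are the only ones it is used for.) -/
noncomputable def tcf (P : Type u) [Preorder P] : Cardinal.{u} :=
  sInf {μ | HasTrueCofinality P μ}

/-! ### Products of cardinals modulo a filter or an ideal -/

section

variable {ι : Type u}

/-- The product `∏ i, lam i` (each `lam i` being the set of ordinals below it), carrying the
quasi-order `≤` modulo the filter `D`. -/
def ReducedProd (lam : ι → Cardinal.{u}) (_D : Filter ι) : Type u :=
  (i : ι) → (lam i).ord.ToType

/-- `f ≤ g mod D` means `{i | f i ≤ g i} ∈ D`. -/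
instance (lam : ι → Cardinal.{u}) (D : Filter ι) : Preorder (ReducedProd lam D) where
  le f g := ∀ᶠ i in D, f i ≤ g i
  le_refl _ := Filter.Eventually.of_forall fun _ => le_rfl
  le_trans _ _ _ h₁ h₂ := by
    filter_upwards [h₁, h₂] with i h h' using h.trans h'

/-- Modulo an ultrafilter, the strict part of `≤ mod D` is `< mod D`. -/
theorem ReducedProd.lt_iff (lam : ι → Cardinal.{u}) (D : Ultrafilter ι)
    (f g : ReducedProd lam (D : Filter ι)) : f < g ↔ ∀ᶠ i in (D : Filter ι), f i < g i := by
  have h : f < g ↔ (∀ᶠ i in (D : Filter ι), f i ≤ g i) ∧ ¬ ∀ᶠ i in (D : Filter ι), g i ≤ f i :=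
    lt_iff_le_not_ge
  rw [h, ← Ultrafilter.eventually_not]
  constructor
  · rintro ⟨-, h₂⟩
    exact h₂.mono fun i hi => not_le.1 hi
  · intro h₁
    exact ⟨h₁.mono fun i hi => hi.le, h₁.mono fun i hi => not_le.2 hi⟩

/-- The filter dual to the ideal `I`: the sets whose complement is in `I`. -/
def dualFilter (I : Order.Ideal (Set ι)) : Filter ι :=
  Filter.comk (· ∈ I) I.bot_mem (fun _ ht _ hs => I.lower hs ht)
    (fun _ hs _ ht => I.sup_mem hs ht)

/-- The filter `D` is disjoint to the ideal `I`. -/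
def DisjointTo (D : Ultrafilter ι) (I : Order.Ideal (Set ι)) : Prop :=
  ∀ A ∈ I, A ∉ D

/-! ### Invariants of ideals -/

/-- `I` is `θ`-weakly saturated: the underlying set cannot be partitioned into `θ` pairwise
disjoint `I`-positive sets. -/
def IsWeaklySaturated (I : Order.Ideal (Set ι)) (θ : Cardinal.{u}) : Prop :=
  ¬ ∃ S : Set (Set ι), #S = θ ∧ S.PairwiseDisjoint id ∧ ⋃₀ S = Set.univ ∧ ∀ A ∈ S, A ∉ I

/-- `wsat I`: the least nonzero `θ` such that `I` is `θ`-weakly saturated.  (A nonempty set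
cannot be partitioned into zero pieces, so `θ = 0` has to be left out.) -/
noncomputable def wsat (I : Order.Ideal (Set ι)) : Cardinal.{u} :=
  sInf {θ | θ ≠ 0 ∧ IsWeaklySaturated I θ}

/-- `lim inf_I lam = min {μ | {i | lam i ≤ μ} ∉ I}`. -/
noncomputable def limInf (I : Order.Ideal (Set ι)) (lam : ι → Cardinal.{u}) : Cardinal.{u} :=
  sInf {μ | {i | lam i ≤ μ} ∉ I}

/-! ### `pcf` and the ideals `J_{<μ}` -/

/-- `pcf_I(lam)`: the set of true cofinalities of `∏ lam / D`, for `D` an ultrafilter disjoint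
to `I`. -/
def pcf (I : Order.Ideal (Set ι)) (lam : ι → Cardinal.{u}) : Set Cardinal.{u} :=
  {μ | ∃ D : Ultrafilter ι, DisjointTo D I ∧ tcf (ReducedProd lam (D : Filter ι)) = μ}

/-- `pcf_I(lam ↾ B) = pcf_{I + (ι ∖ B)}(lam)`, where `I + (ι ∖ B)` is the ideal generated by `I`
and `ι ∖ B`; it is empty if `B ∈ I`. -/
def pcfRestrict (I : Order.Ideal (Set ι)) (lam : ι → Cardinal.{u}) (B : Set ι) :
    Set Cardinal.{u} :=
  pcf (I ⊔ Order.Ideal.principal Bᶜ) lam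

/-- `J_{<μ}[lam]` (with respect to `I`): the (possibly improper) ideal of those `B` such that
`tcf (∏ lam / D) ≥ μ` for no ultrafilter `D` disjoint to `I` with `B ∈ D`. -/
def JLt (I : Order.Ideal (Set ι)) (lam : ι → Cardinal.{u}) (μ : Cardinal.{u}) :
    Order.Ideal (Set ι) where
  carrier := {B | ¬ ∃ D : Ultrafilter ι,
    DisjointTo D I ∧ B ∈ D ∧ μ ≤ tcf (ReducedProd lam (D : Filter ι))}
  lower' := by
    rintro A B hBA hA ⟨D, hD, hB, hμ⟩
    exact hA ⟨D, hD, Filter.mem_of_superset hB hBA, hμ⟩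
  nonempty' := ⟨∅, by
    rintro ⟨D, -, h, -⟩
    exact D.empty_notMem h⟩
  directed' := by
    intro A hA B hB
    refine ⟨A ∪ B, ?_, Set.subset_union_left, Set.subset_union_right⟩
    rintro ⟨D, hD, h, hμ⟩
    rcases Ultrafilter.union_mem_iff.1 h with h | h
    · exact hA ⟨D, hD, h, hμ⟩
    · exact hB ⟨D, hD, h, hμ⟩

/-- `J_{≤μ}[lam] = J_{<μ⁺}[lam]`. -/
noncomputable def JLe (I : Order.Ideal (Set ι)) (lam : ι → Cardinal.{u}) (μ : Cardinal.{u}) :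
    Order.Ideal (Set ι) :=
  JLt I lam (succ μ)

/-- `⟨Bs μ : μ ∈ c⟩` is a generating sequence for `lam`: `c ⊆ pcf(lam)` and
`J_{≤μ}[lam] = J_{<μ}[lam] + Bs μ` for every `μ ∈ c`. -/
def IsGeneratingSequence (I : Order.Ideal (Set ι)) (lam : ι → Cardinal.{u})
    (c : Set Cardinal.{u}) (Bs : c → Set ι) : Prop :=
  c ⊆ pcf I lam ∧
    ∀ μ : c, JLe I lam μ = JLt I lam μ ⊔ Order.Ideal.principal (Bs μ)

/-- The basic assumption on `(lam, I, θ)`: `lam` is a sequence of (infinite) regular cardinals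
and either `min lam > θ ≥ wsat I`, or `lim inf_I lam ≥ θ ≥ wsat I` and `∏ lam / I` is
`θ⁺`-directed. -/
def BasicAssumption (I : Order.Ideal (Set ι)) (lam : ι → Cardinal.{u}) (θ : Cardinal.{u}) :
    Prop :=
  (∀ i, (lam i).IsRegular) ∧
    (((∀ i, θ < lam i) ∧ wsat I ≤ θ) ∨
      (θ ≤ limInf I lam ∧ wsat I ≤ θ ∧
        IsCardDirected (ReducedProd lam (dualFilter I)) (succ θ)))

end

end PcfTheory

namespace PcfTheory

/-! ### Recursive choice and total quasi-orders -/

/-! Everything rests on `Admissible.isCardDirected_JLt`: the product modulo `J_{<μ}` is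
`μ`-directed. Hence an ultrafilter disjoint to `J_{<μ}` has true cofinality at least `μ`, so every
`D` contains a set of `J_{≤tcf}`.

For (1), if no finite union covers `B` modulo `I`, compactness gives `D` containing `B` and avoiding
every `Bs μ`. With `μ` its true cofinality, `D` also avoids `J_{<μ}`, hence all of `J_{≤μ}`, a
contradiction.

For (2), an ultrafilter disjoint to all proper `J_{<μ}` at once realizes the maximum of `pcf`, which
bounds the cofinality from below since a set cofinal mod `I` is cofinal mod each `D`. For the upper
bound, one sequence of length `ν` serves all `D` of cofinality `ν`; upper bounds of finite subsets
of the union of these sequences are cofinal, again by compactness.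

Both hard lemmas use weak saturation alike: a recursion of length `θ` that could not stop would
yield `θ` disjoint sets, each in an ultrafilter disjoint to `I`. -/

theorem exists_forall_rel_of_wellFoundedLT {T : Type*} {X : Type*} [Preorder T] [WellFoundedLT T]
    (R : (t : T) → (Set.Iio t → X) → X → Prop) (h : ∀ t q, ∃ x, R t q x) :
    ∃ p : T → X, ∀ t, R t (fun s => p s) (p t) := by
  choose F hF using h
  let p : T → X := (wellFounded_lt (α := T)).fix fun t ih => F t fun s => ih s s.2
  refine ⟨p, fun t => ?_⟩
  have : p t = F t fun s => p s := WellFounded.fix_eq _ _ t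
  rw [this]
  exact hF _ _

section Total

variable {P : Type u} [Preorder P]

theorem exists_forall_lt_of_not_isCofinal (htot : ∀ a b : P, a ≤ b ∨ b ≤ a) {A : Set P}
    (hA : ¬ IsCofinal A) : ∃ q, ∀ p ∈ A, p < q := by
  simp only [IsCofinal, not_forall, not_exists, not_and] at hA
  obtain ⟨q, hq⟩ := hA
  exact ⟨q, fun p hp => lt_iff_le_not_ge.2 ⟨(htot p q).resolve_right (hq p hp), hq p hp⟩⟩

theorem hasTrueCofinality_cof (htot : ∀ a b : P, a ≤ b ∨ b ≤ a) :
    HasTrueCofinality P (cof P) := by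
  obtain ⟨S, hS, hSc⟩ := exists_cof_eq P
  obtain ⟨e⟩ : Nonempty ((cof P).ord.ToType ≃ S) := Cardinal.eq.1 (by simp [hSc])
  obtain ⟨p, hp⟩ := exists_forall_rel_of_wellFoundedLT
    (fun (t : (cof P).ord.ToType) (q : Set.Iio t → P) x => (∀ s, q s < x) ∧ (e t : P) ≤ x) (by
      intro t q
      have hq : ¬ IsCofinal (Set.range q) := fun hc =>
        ((cof_le hc).trans mk_range_le).not_gt (by simpa using mk_Iio_lt t)
      obtain ⟨x, hx⟩ := exists_forall_lt_of_not_isCofinal htot hq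
      rcases htot x (e t) with h | h
      · exact ⟨e t, fun s => (hx _ ⟨s, rfl⟩).trans_le h, le_rfl⟩
      · exact ⟨x, fun s => hx _ ⟨s, rfl⟩, h⟩)
  refine ⟨p, fun a b hab => (hp b).1 ⟨a, hab⟩, fun q => ?_⟩
  obtain ⟨s, hs, hqs⟩ := hS q
  exact ⟨e.symm ⟨s, hs⟩, hqs.trans (by simpa using (hp (e.symm ⟨s, hs⟩)).2)⟩

theorem hasTrueCofinality_tcf (htot : ∀ a b : P, a ≤ b ∨ b ≤ a) :
    HasTrueCofinality P (tcf P) :=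
  csInf_mem (s := {μ | HasTrueCofinality P μ}) ⟨_, hasTrueCofinality_cof htot⟩

theorem tcf_le_cof (htot : ∀ a b : P, a ≤ b ∨ b ≤ a) : tcf P ≤ cof P :=
  csInf_le' (hasTrueCofinality_cof htot)

theorem exists_forall_lt_of_mk_lt_tcf (htot : ∀ a b : P, a ≤ b ∨ b ≤ a) {A : Set P}
    (hA : #A < tcf P) : ∃ q, ∀ p ∈ A, p < q :=
  exists_forall_lt_of_not_isCofinal htot fun h =>
    (cof_le h).not_gt (hA.trans_le (tcf_le_cof htot))

end Total

section Directed

variable {P : Type u} [Preorder P] {μ κ : Cardinal.{u}}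

/-- A bound of the corresponding values lies strictly below some term of the sequence, whose index
then bounds the given indices. -/
theorem HasTrueCofinality.isCardDirected [NoMaxOrder P] (h : HasTrueCofinality P μ)
    (hd : IsCardDirected P κ) : IsCardDirected μ.ord.ToType κ := by
  obtain ⟨p, hp, hc⟩ := h
  intro A hA
  obtain ⟨q, hq⟩ := hd (p '' A) (mk_image_le.trans_lt hA)
  obtain ⟨r, hr⟩ := exists_gt q
  obtain ⟨a, ha⟩ := hc r
  refine ⟨a, fun b hb => not_lt.1 fun hab => ?_⟩
  exact lt_irrefl _ (((hp _ _ hab).trans_le (hq _ ⟨b, hb, rfl⟩)).trans (hr.trans_le ha))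

theorem HasTrueCofinality.le_of_isCardDirected [NoMaxOrder P] (h : HasTrueCofinality P μ)
    (hd : IsCardDirected P κ) : κ ≤ μ := by
  obtain ⟨p, hp, hc⟩ := h
  by_contra! hlt
  obtain ⟨q, hq⟩ := hd (Set.range p) (mk_range_le.trans_lt (by simpa using hlt))
  obtain ⟨r, hr⟩ := exists_gt q
  obtain ⟨a, ha⟩ := hc r
  exact lt_irrefl _ ((hr.trans_le ha).trans_le (hq _ ⟨a, rfl⟩))

end Directed

/-! ### Reduced products -/

section

variable {ι : Type u} {I : Order.Ideal (Set ι)} {lam : ι → Cardinal.{u}} {θ : Cardinal.{u}}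

theorem mem_dualFilter {s : Set ι} : s ∈ dualFilter I ↔ sᶜ ∈ I := Iff.rfl

theorem DisjointTo.le_dualFilter {D : Ultrafilter ι} (h : DisjointTo D I) :
    (D : Filter ι) ≤ dualFilter I := fun _ hs =>
  Ultrafilter.compl_notMem_iff.1 (h _ hs)

theorem disjointTo_of_le {D : Ultrafilter ι} (h : (D : Filter ι) ≤ dualFilter I) :
    DisjointTo D I := fun A hA hAD =>
  Ultrafilter.compl_notMem_iff.2 hAD (h (by rwa [mem_dualFilter, compl_compl]))

theorem exists_disjointTo_forall_mem {J : Type*} (X : J → Set ι)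
    (h : ∀ s : Finset J, ⋂ j ∈ s, X j ∉ I) :
    ∃ D : Ultrafilter ι, DisjointTo D I ∧ ∀ j, X j ∈ D := by
  have : (dualFilter I ⊓ (⨅ j : J, Filter.principal (X j) : Filter ι)).NeBot := by
    rw [inf_comm, (Filter.hasBasis_iInf_principal_finite X).inf_neBot_iff]
    intro t ht s hs
    by_contra hne
    rw [Set.not_nonempty_iff_eq_empty, ← Set.disjoint_iff_inter_eq_empty,
      ← Set.subset_compl_iff_disjoint_right] at hne
    exact h ht.toFinset (by simpa using I.lower hne hs)
  refine ⟨Ultrafilter.of (dualFilter I ⊓ ⨅ j, Filter.principal (X j)),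
    disjointTo_of_le ((Ultrafilter.of_le _).trans inf_le_left),
    fun j => ?_⟩
  exact ((Ultrafilter.of_le _).trans (inf_le_right.trans (iInf_le _ j)))
    (Filter.mem_principal_self _)

theorem reducedProd_total (D : Ultrafilter ι) (f g : ReducedProd lam (D : Filter ι)) :
    f ≤ g ∨ g ≤ f :=
  Ultrafilter.eventually_or.1 (Filter.Eventually.of_forall fun i => le_total (f i) (g i))

theorem IsCardDirected.mono_filter {F G : Filter ι} (hGF : G ≤ F) {κ : Cardinal.{u}}
    (h : IsCardDirected (ReducedProd lam F) κ) : IsCardDirected (ReducedProd lam G) κ := by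
  intro A hA
  obtain ⟨q, hq⟩ := h A hA
  exact ⟨q, fun p hp => hGF (hq p hp)⟩

theorem exists_forall_gt_of_isRegular {κ : Cardinal.{u}} (hκ : κ.IsRegular)
    {A : Set κ.ord.ToType} (hA : #A < κ) : ∃ b, ∀ a ∈ A, a < b := by
  refine exists_forall_lt_of_not_isCofinal le_total fun hc => ?_
  have := cof_le hc
  rw [Ordinal.cof_toType, hκ.cof_ord] at this
  exact this.not_gt hA

theorem noMaxOrder_reducedProd (hreg : ∀ i, (lam i).IsRegular) (F : Filter ι) [F.NeBot] :
    NoMaxOrder (ReducedProd lam F) := by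
  refine ⟨fun f => ?_⟩
  have (i : ι) : ∃ b, f i < b := by
    obtain ⟨b, hb⟩ := exists_forall_gt_of_isRegular (hreg i) (A := {f i})
      (by simpa using (hreg i).nat_lt 1)
    exact ⟨b, hb _ rfl⟩
  choose g hg using this
  refine ⟨g, lt_iff_le_not_ge.2 ⟨Filter.Eventually.of_forall fun i => (hg i).le, fun h => ?_⟩⟩
  obtain ⟨i, hi⟩ := Filter.Eventually.exists (f := F) h
  exact hi.not_gt (hg i)

/-- Directedness would give one exceptional set per function. Here a single one, `{i | lam i ≤ #T}`,
serves all of `T`, as the recursions of length `θ` require. -/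
theorem exists_forall_le_of_mk_lt (hreg : ∀ i, (lam i).IsRegular)
    (hlim : ∀ μ < θ, {i | lam i ≤ μ} ∈ I) {T : Type u} (hT : #T < θ)
    (h : T → (i : ι) → (lam i).ord.ToType) :
    ∃ g : (i : ι) → (lam i).ord.ToType, ∀ᶠ i in dualFilter I, ∀ t, h t i ≤ g i := by
  have (i : ι) : ∃ b, #T < lam i → ∀ t, h t i ≤ b := by
    by_cases hi : #T < lam i
    · obtain ⟨b, hb⟩ := exists_forall_gt_of_isRegular (hreg i)
        (A := Set.range fun t => h t i) (mk_range_le.trans_lt hi)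
      exact ⟨b, fun _ t => (hb _ ⟨t, rfl⟩).le⟩
    · obtain ⟨b, -⟩ := exists_forall_gt_of_isRegular (hreg i) (A := ∅)
        (by simpa using (hreg i).pos)
      exact ⟨b, fun h => absurd h hi⟩
  choose g hg using this
  refine ⟨g, mem_dualFilter.2 (I.lower (fun i hi => ?_) (hlim _ hT))⟩
  by_contra hlt
  exact hi (hg i (not_le.1 hlt))

theorem exists_forall_le_of_finite (hreg : ∀ i, (lam i).IsRegular) {T : Type*} [Finite T]
    (h : T → (i : ι) → (lam i).ord.ToType) :
    ∃ g : (i : ι) → (lam i).ord.ToType, ∀ i t, h t i ≤ g i := by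
  have (i : ι) : ∃ b, ∀ t, h t i ≤ b := by
    have : Nonempty (lam i).ord.ToType := by
      rw [← mk_ne_zero_iff]
      simpa using (hreg i).ne_zero
    obtain ⟨b, hb⟩ := (Set.finite_range fun t => h t i).bddAbove
    exact ⟨b, fun t => hb ⟨t, rfl⟩⟩
  choose g hg using this
  exact ⟨g, hg⟩

/-! ### Consequences of the basic assumption -/

theorem isWeaklySaturated_wsat (I : Order.Ideal (Set ι)) :
    wsat I ≠ 0 ∧ IsWeaklySaturated I (wsat I) := by
  refine csInf_mem (s := {θ | θ ≠ 0 ∧ IsWeaklySaturated I θ})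
    ⟨succ #(Set ι), (succ_pos _).ne', ?_⟩
  rintro ⟨S, hS, -⟩
  exact (mk_set_le S).not_gt (hS ▸ lt_succ _)

theorem IsWeaklySaturated.exists_mem {σ : Cardinal.{u}} (hσ : σ ≠ 0)
    (h : IsWeaklySaturated I σ) {T : Type u} (hT : σ ≤ #T) (A : T → Set ι)
    (hA : Pairwise (Function.onFun Disjoint A)) : ∃ t, A t ∈ I := by
  by_contra! hpos
  obtain ⟨U, hU⟩ := le_mk_iff_exists_set.1 hT
  have hUne : U.Nonempty := by
    rw [Set.nonempty_iff_ne_empty]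
    rintro rfl
    exact hσ (by simpa using hU.symm)
  obtain ⟨t₀, ht₀⟩ := hUne
  classical
  -- One piece absorbs everything uncovered, turning a disjoint family into a partition.
  let B : U → Set ι := fun t => if (t : T) = t₀ then A t ∪ (⋃ s : U, A s)ᶜ else A t
  have hAB (t : U) : A t ⊆ B t := by
    by_cases ht : (t : T) = t₀ <;> simp [B, ht]
  have hBA (t : U) (i : ι) (hi : i ∈ B t) :
      i ∈ A t ∨ ((t : T) = t₀ ∧ i ∉ ⋃ s : U, A s) := by
    by_cases ht : (t : T) = t₀
    · simp only [B, ht, if_true] at hi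
      rcases hi with hi | hi
      · exact Or.inl (ht ▸ hi)
      · exact Or.inr ⟨ht, hi⟩
    · simp only [B, ht, if_false] at hi
      exact Or.inl hi
  have hBpos (t : U) : B t ∉ I := fun hB => hpos t (I.lower (hAB t) hB)
  have hB : Pairwise (Function.onFun Disjoint B) := by
    intro s t hst
    refine Set.disjoint_left.2 fun i hs ht => ?_
    rcases hBA s i hs with hs | ⟨hs, hs'⟩ <;> rcases hBA t i ht with ht | ⟨ht, ht'⟩
    · exact Set.disjoint_left.1 (hA fun h => hst (Subtype.ext h)) hs ht
    · exact ht' (Set.mem_iUnion.2 ⟨s, hs⟩)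
    · exact hs' (Set.mem_iUnion.2 ⟨t, ht⟩)
    · exact hst (Subtype.ext (hs.trans ht.symm))
  have hinj : Function.Injective B := by
    intro s t hst
    by_contra hne
    have : B s = ∅ := by
      have := hB hne
      rwa [Function.onFun, ← hst, disjoint_self] at this
    exact hBpos s (this ▸ I.bot_mem)
  refine h ⟨Set.range B, by rw [mk_range_eq B hinj, hU], ?_, ?_, ?_⟩
  · exact hB.range_pairwise
  · refine Set.eq_univ_of_forall fun i => ?_
    by_cases hi : i ∈ ⋃ s : U, A s
    · obtain ⟨s, hs⟩ := Set.mem_iUnion.1 hi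
      exact ⟨B s, ⟨s, rfl⟩, hAB s hs⟩
    · refine ⟨B ⟨t₀, ht₀⟩, ⟨_, rfl⟩, ?_⟩
      simp only [B, if_true]
      exact Or.inr hi
  · rintro _ ⟨t, rfl⟩
    exact hBpos t

/-- The consequences of the basic assumption on which the `pcf` theorem rests. -/
structure Admissible (I : Order.Ideal (Set ι)) (lam : ι → Cardinal.{u}) (θ : Cardinal.{u}) :
    Prop where
  isRegular : ∀ i, (lam i).IsRegular
  le_mem : ∀ μ < θ, {i | lam i ≤ μ} ∈ I
  exists_mem : ∀ A : θ.ord.ToType → Set ι, Pairwise (Function.onFun Disjoint A) → ∃ t, A t ∈ I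
  directed : IsCardDirected (ReducedProd lam (dualFilter I)) (succ θ)

theorem BasicAssumption.admissible (h : BasicAssumption I lam θ) : Admissible I lam θ := by
  obtain ⟨hreg, h⟩ := h
  have hw : wsat I ≤ θ := by rcases h with h | h <;> tauto
  refine ⟨hreg, ?_, fun A hA =>
    (isWeaklySaturated_wsat I).2.exists_mem (isWeaklySaturated_wsat I).1 (by simpa using hw) A hA,
    ?_⟩
  · intro μ hμ
    rcases h with ⟨h, -⟩ | ⟨h, -⟩
    · convert I.bot_mem
      exact Set.eq_empty_of_forall_notMem fun i hi => (hμ.trans (h i)).not_ge hi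
    · by_contra hn
      exact notMem_of_lt_csInf' (hμ.trans_le h) hn
  · rcases h with ⟨h, -⟩ | ⟨-, -, h⟩
    · intro A hA
      have hA' : #A ≤ θ := lt_succ_iff.1 hA
      have (i : ι) : ∃ b, ∀ f ∈ A, f i ≤ b := by
        obtain ⟨b, hb⟩ := exists_forall_gt_of_isRegular (hreg i) (A := (fun f => f i) '' A)
          (mk_image_le.trans_lt (hA'.trans_lt (h i)))
        exact ⟨b, fun f hf => (hb _ ⟨f, hf, rfl⟩).le⟩
      choose g hg using this
      exact ⟨g, fun f hf => Filter.Eventually.of_forall fun i => hg i f hf⟩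
    · exact h

/-! ### Directedness modulo `J_{<μ}` -/

theorem DisjointTo.JLt {D : Ultrafilter ι} (h : DisjointTo D I) {μ : Cardinal.{u}}
    (hμ : μ ≤ tcf (ReducedProd lam (D : Filter ι))) : DisjointTo D (JLt I lam μ) :=
  fun _ hA hAD => hA ⟨D, h, hAD, hμ⟩

theorem le_JLt (μ : Cardinal.{u}) : I ≤ JLt I lam μ := by
  rintro A hA ⟨D, hD, hAD, -⟩
  exact hD A hA hAD

theorem dualFilter_anti {I J : Order.Ideal (Set ι)} (h : I ≤ J) :
    dualFilter J ≤ dualFilter I := fun _ hs => h hs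

theorem disjointTo_of_disjointTo_JLt {D : Ultrafilter ι} {μ : Cardinal.{u}}
    (h : DisjointTo D (JLt I lam μ)) : DisjointTo D I :=
  fun A hA => h A (le_JLt μ hA)

/-- Induction on the size `κ` of the family. For `κ > θ` it may be replaced by an increasing
sequence of length `κ`, and only regular `κ` is not immediate from the induction hypothesis. -/
theorem Admissible.isCardDirected_JLt (h : Admissible I lam θ) (μ : Cardinal.{u}) :
    IsCardDirected (ReducedProd lam (dualFilter (JLt I lam μ))) μ := by
  suffices H : ∀ κ < μ, ∀ A : Set (ReducedProd lam (dualFilter (JLt I lam μ))), #A = κ →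
      ∃ q, ∀ p ∈ A, p ≤ q from fun A hA => H _ hA A rfl
  intro κ
  induction κ using WellFoundedLT.induction with | _ κ ih
  intro hκ A hA
  rcases le_or_gt κ θ with hκθ | hκθ
  · exact h.directed.mono_filter (dualFilter_anti (le_JLt μ)) A (lt_succ_iff.2 (hA ▸ hκθ))
  obtain ⟨e⟩ : Nonempty (κ.ord.ToType ≃ A) := Cardinal.eq.1 (by simp [hA])
  obtain ⟨f, hf⟩ := exists_forall_rel_of_wellFoundedLT
    (fun (t : κ.ord.ToType) (q : Set.Iio t → ReducedProd lam (dualFilter (JLt I lam μ))) x =>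
      (∀ s, q s ≤ x) ∧ e t ≤ x) (by
      intro t q
      have ht : #(Set.range q) < κ := mk_range_le.trans_lt (by simpa using mk_Iio_lt t)
      obtain ⟨x, hx⟩ := ih _ ht (ht.trans hκ) (Set.range q) rfl
      have hx' (s) : q s ≤ x := hx _ ⟨s, rfl⟩
      let y : ReducedProd lam (dualFilter (JLt I lam μ)) :=
        fun i => max (x i) ((e t : ReducedProd lam (dualFilter (JLt I lam μ))) i)
      have hy : x ≤ y := Filter.Eventually.of_forall fun i => le_max_left _ _
      exact ⟨y, fun s => (hx' s).trans hy, Filter.Eventually.of_forall fun i => le_max_right _ _⟩)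
  have hmono (a b) (hab : a ≤ b) : f a ≤ f b := by
    rcases hab.eq_or_lt with rfl | hab
    · exact le_rfl
    · exact (hf b).1 ⟨a, hab⟩
  suffices H : ∃ q, ∀ a, f a ≤ q by
    obtain ⟨q, hq⟩ := H
    refine ⟨q, fun p hp => ?_⟩
    have := (hf (e.symm ⟨p, hp⟩)).2
    rw [e.apply_symm_apply] at this
    exact this.trans (hq _)
  by_cases hW : ∃ S : Set κ.ord.ToType, #S < κ ∧ IsCofinal S
  · obtain ⟨S, hS, hSc⟩ := hW
    have hS' : #(f '' S) < κ := mk_image_le.trans_lt hS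
    obtain ⟨q, hq⟩ := ih _ hS' (hS'.trans hκ) _ rfl
    refine ⟨q, fun a => ?_⟩
    obtain ⟨s, hs, has⟩ := hSc a
    exact (hmono _ _ has).trans (hq _ ⟨s, hs, rfl⟩)
  push Not at hW
  by_contra! hno
  -- Failure of `g` as a bound makes `{i | g i < f a i}` positive for `J_{<μ}`. So it lies in some
  -- `D` with `tcf ≥ μ > κ`, modulo which the whole sequence is bounded by some `k`.
  have step (g : (i : ι) → (lam i).ord.ToType) : ∃ D : Ultrafilter ι,
      DisjointTo D (JLt I lam μ) ∧ ∃ a, ∃ k : (i : ι) → (lam i).ord.ToType,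
        (∀ᶠ i in (D : Filter ι), g i < f a i) ∧ ∀ b, ∀ᶠ i in (D : Filter ι), f b i ≤ k i := by
    obtain ⟨a, ha⟩ := hno g
    obtain ⟨D, hD, hDa, hDμ⟩ := not_not.1 (show ¬ {i | f a i ≤ g i}ᶜ ∈ JLt I lam μ from ha)
    obtain ⟨k, hk⟩ := exists_forall_lt_of_mk_lt_tcf (reducedProd_total (lam := lam) D)
      (A := Set.range f) (mk_range_le.trans_lt (by simpa using hκ.trans_le hDμ))
    exact ⟨D, hD.JLt hDμ, a, k, Filter.mem_of_superset hDa fun i (hi : ¬ f a i ≤ g i) => not_le.1 hi,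
      fun b => (hk _ ⟨b, rfl⟩).le⟩
  obtain ⟨p, hp⟩ := exists_forall_rel_of_wellFoundedLT
    (fun (t : θ.ord.ToType) (q : Set.Iio t → Ultrafilter ι × κ.ord.ToType ×
        ((i : ι) → (lam i).ord.ToType)) x =>
      DisjointTo x.1 (JLt I lam μ) ∧
        (∀ᶠ i in (x.1 : Filter ι), ∀ s, (q s).2.2 i < f x.2.1 i) ∧
        ∀ b, ∀ᶠ i in (x.1 : Filter ι), f b i ≤ x.2.2 i) (by
      intro t q
      obtain ⟨g, hg⟩ := exists_forall_le_of_mk_lt h.isRegular h.le_mem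
        (T := Set.Iio t) (by simpa using mk_Iio_lt t) (fun s => (q s).2.2)
      obtain ⟨D, hD, a, k, hga, hk⟩ := step g
      refine ⟨(D, a, k), hD, ?_, hk⟩
      filter_upwards [hga, (disjointTo_of_disjointTo_JLt hD).le_dualFilter hg] with i hi hi' s
      exact (hi' s).trans_lt hi)
  -- As `θ < κ` and no small set is cofinal in `κ`, one index `a` lies above all those chosen; `f a`
  -- then separates the bounds of all stages.
  obtain ⟨a, ha⟩ := exists_forall_lt_of_not_isCofinal le_total
    (hW (Set.range fun t => (p t).2.1) (mk_range_le.trans_lt (by simpa using hκθ)))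
  obtain ⟨t, ht⟩ := h.exists_mem
    (fun t => {i | (∀ s : Set.Iio t, (p s).2.2 i < f a i) ∧ f a i ≤ (p t).2.2 i}) (by
      rw [pairwise_disjoint_on]
      intro s t hst
      refine Set.disjoint_left.2 fun i hs ht => ?_
      exact (ht.1 ⟨s, hst⟩).not_ge hs.2)
  obtain ⟨hD, hlt, hle⟩ := hp t
  refine disjointTo_of_disjointTo_JLt hD _ ht ?_
  have hat : ∀ᶠ i in ((p t).1 : Filter ι), f (p t).2.1 i ≤ f a i :=
    hD.le_dualFilter (hmono _ _ (ha _ ⟨t, rfl⟩).le)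
  filter_upwards [hlt, hle a, hat] with i h₁ h₂ h₃
  exact ⟨fun s => (h₁ s).trans_le h₃, h₂⟩

theorem Admissible.le_tcf (h : Admissible I lam θ) {D : Ultrafilter ι} {μ : Cardinal.{u}}
    (hD : DisjointTo D (JLt I lam μ)) : μ ≤ tcf (ReducedProd lam (D : Filter ι)) := by
  have := noMaxOrder_reducedProd h.isRegular (D : Filter ι)
  exact (hasTrueCofinality_tcf (reducedProd_total D)).le_of_isCardDirected
    ((h.isCardDirected_JLt μ).mono_filter hD.le_dualFilter)

theorem Admissible.exists_mem_JLe (h : Admissible I lam θ) (D : Ultrafilter ι) :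
    ∃ A ∈ JLe I lam (tcf (ReducedProd lam (D : Filter ι))), A ∈ D := by
  by_contra! hn
  exact (h.le_tcf hn).not_gt (lt_succ _)

/-! ### Compactness of generating sequences -/

theorem Admissible.exists_finset_diff_mem (h : Admissible I lam θ) {c : Set Cardinal.{u}}
    {Bs : c → Set ι} {B : Set ι} (hgen : IsGeneratingSequence I lam c Bs)
    (hB : pcfRestrict I lam B ⊆ c) : ∃ d : Finset c, B \ (⋃ μ ∈ d, Bs μ) ∈ I := by
  classical
  by_contra! hn
  obtain ⟨D, hD, hDX⟩ := exists_disjointTo_forall_mem (I := I)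
    (fun o : Option c => o.elim B fun μ => (Bs μ)ᶜ) (by
      intro s hs
      refine hn s.eraseNone (I.lower ?_ hs)
      rintro i ⟨hiB, hi⟩
      simp only [Set.mem_iUnion, not_exists] at hi
      simp only [Set.mem_iInter]
      rintro (_ | μ) hμ
      · exact hiB
      · exact hi μ (Finset.mem_eraseNone.2 hμ))
  have hDB : DisjointTo D (I ⊔ Order.Ideal.principal Bᶜ) := by
    intro A hA hAD
    obtain ⟨x, hx, y, hy, hxy⟩ := Order.Ideal.mem_sup.1 hA
    rcases Ultrafilter.union_mem_iff.1 (Filter.mem_of_superset hAD hxy) with hxD | hyD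
    · exact hD x hx hxD
    · exact Ultrafilter.compl_notMem_iff.2 (hDX none)
        (Filter.mem_of_superset hyD (Order.Ideal.mem_principal.1 hy))
  let μ : c := ⟨_, hB ⟨D, hDB, rfl⟩⟩
  obtain ⟨A, hA, hAD⟩ := h.exists_mem_JLe (lam := lam) D
  rw [hgen.2 μ] at hA
  obtain ⟨x, hx, y, hy, hxy⟩ := Order.Ideal.mem_sup.1 hA
  rcases Ultrafilter.union_mem_iff.1 (Filter.mem_of_superset hAD hxy) with hxD | hyD
  · exact hD.JLt le_rfl x hx hxD
  · exact Ultrafilter.compl_mem_iff_notMem.1 (hDX (some μ))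
      (Filter.mem_of_superset hyD (Order.Ideal.mem_principal.1 hy))

/-! ### The maximum of `pcf` -/

theorem JLt_mono {μ ν : Cardinal.{u}} (h : μ ≤ ν) : JLt I lam μ ≤ JLt I lam ν := by
  rintro A hA ⟨D, hD, hAD, hν⟩
  exact hA ⟨D, hD, hAD, h.trans hν⟩

theorem dualFilter_neBot (hI : I.IsProper) : (dualFilter I).NeBot := by
  refine ⟨fun h => hI.top_notMem ?_⟩
  have : (∅ : Set ι) ∈ dualFilter I := h ▸ Filter.mem_bot
  simpa [mem_dualFilter] using this

theorem Admissible.exists_isGreatest_pcf (h : Admissible I lam θ) (hI : I.IsProper) :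
    ∃ μ, IsGreatest (pcf I lam) μ := by
  -- The `μ` with `J_{<μ}` proper. If `E` had larger true cofinality than `D`, the successor of
  -- `tcf` of `D` would lie in `S`, forcing `D` above itself.
  let S : Set Cardinal.{u} := {μ | (dualFilter (JLt I lam μ)).NeBot}
  have h0 : (0 : Cardinal.{u}) ∈ S := by
    have := dualFilter_neBot hI
    exact Filter.neBot_of_le (f := Ultrafilter.of (dualFilter I))
      ((disjointTo_of_le (Ultrafilter.of_le _)).JLt zero_le).le_dualFilter
  have : Nonempty S := ⟨⟨0, h0⟩⟩
  have hne : (⨅ μ : S, dualFilter (JLt I lam μ)).NeBot :=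
    Filter.iInf_neBot_of_directed' (Antitone.directed_ge fun μ ν hμν =>
      dualFilter_anti (JLt_mono hμν)) fun μ => μ.2
  let D := Ultrafilter.of (⨅ μ : S, dualFilter (JLt I lam μ))
  have hD (μ : S) : DisjointTo D (JLt I lam μ) :=
    disjointTo_of_le ((Ultrafilter.of_le _).trans (iInf_le _ μ))
  refine ⟨tcf (ReducedProd lam (D : Filter ι)),
    ⟨D, disjointTo_of_disjointTo_JLt (hD ⟨0, h0⟩), rfl⟩, ?_⟩
  rintro _ ⟨E, hE, rfl⟩
  by_contra! hlt
  have hs : succ (tcf (ReducedProd lam (D : Filter ι))) ∈ S :=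
    Filter.neBot_of_le (f := E) (hE.JLt (succ_le_of_lt hlt)).le_dualFilter
  exact (h.le_tcf (hD ⟨_, hs⟩)).not_gt (lt_succ _)

/-! ### Universal sequences and the cofinality of the reduced product -/

/-- There is a sequence of length `μ` that is cofinal in every ultraproduct of cofinality `μ`. -/
theorem Admissible.exists_universal_sequence (h : Admissible I lam θ) (μ : Cardinal.{u}) :
    ∃ F : μ.ord.ToType → (i : ι) → (lam i).ord.ToType, ∀ D : Ultrafilter ι, DisjointTo D I →
      tcf (ReducedProd lam (D : Filter ι)) = μ → ∀ g : (i : ι) → (lam i).ord.ToType,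
        ∃ a, ∀ᶠ i in (D : Filter ι), g i ≤ F a i := by
  by_contra! hno
  have step (F : μ.ord.ToType → (i : ι) → (lam i).ord.ToType) : ∃ D : Ultrafilter ι,
      DisjointTo D I ∧ IsCardDirected μ.ord.ToType (succ θ) ∧
      ∃ p : μ.ord.ToType → (i : ι) → (lam i).ord.ToType, ∃ k : (i : ι) → (lam i).ord.ToType,
        (∀ a b, a ≤ b → ∀ᶠ i in (D : Filter ι), p a i ≤ p b i) ∧
        (∀ g : (i : ι) → (lam i).ord.ToType, ∃ a, ∀ᶠ i in (D : Filter ι), g i ≤ p a i) ∧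
        ∀ a, ∀ᶠ i in (D : Filter ι), F a i < k i := by
    obtain ⟨D, hD, hDμ, k, hk⟩ := hno F
    have hcof := hasTrueCofinality_tcf (reducedProd_total (lam := lam) D)
    rw [hDμ] at hcof
    have := noMaxOrder_reducedProd h.isRegular (D : Filter ι)
    obtain ⟨p, hp, hpc⟩ := id hcof
    refine ⟨D, hD, hcof.isCardDirected (h.directed.mono_filter hD.le_dualFilter), p, k, ?_, hpc, hk⟩
    intro a b hab
    rcases hab.eq_or_lt with rfl | hab
    · exact Filter.Eventually.of_forall fun i => le_rfl
    · exact (hp a b hab).le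
  obtain ⟨p, hp⟩ := exists_forall_rel_of_wellFoundedLT
    (fun (t : θ.ord.ToType) (q : Set.Iio t → Ultrafilter ι ×
        (μ.ord.ToType → (i : ι) → (lam i).ord.ToType) × ((i : ι) → (lam i).ord.ToType)) x =>
      DisjointTo x.1 I ∧ IsCardDirected μ.ord.ToType (succ θ) ∧
        (∀ a b, a ≤ b → ∀ᶠ i in (x.1 : Filter ι), x.2.1 a i ≤ x.2.1 b i) ∧
        (∀ g : (i : ι) → (lam i).ord.ToType, ∃ a, ∀ᶠ i in (x.1 : Filter ι), g i ≤ x.2.1 a i) ∧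
        ∀ a, ∀ᶠ i in (x.1 : Filter ι), ∀ s, (q s).2.1 a i < x.2.2 i) (by
      intro t q
      -- The next candidate dominates, index by index, all earlier cofinal sequences; its failure
      -- gives `k` above all of them modulo the new ultrafilter.
      choose F hF using fun a => exists_forall_le_of_mk_lt h.isRegular h.le_mem
        (T := Set.Iio t) (by simpa using mk_Iio_lt t) (fun s => (q s).2.1 a)
      obtain ⟨D, hD, hdir, r, k, hmono, hcof, hk⟩ := step F
      refine ⟨(D, r, k), hD, hdir, hmono, hcof, fun a => ?_⟩
      filter_upwards [hk a, hD.le_dualFilter (hF a)] with i hi hi' s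
      exact (hi' s).trans_lt hi)
  obtain ⟨k, hk⟩ := h.directed (Set.range fun t => (p t).2.2)
    (lt_succ_iff.2 (mk_range_le.trans (by simp)))
  have hk' (t) : ∀ᶠ i in dualFilter I, (p t).2.2 i ≤ k i := hk _ ⟨t, rfl⟩
  choose a ha using fun t => (hp t).2.2.2.1 k
  -- The empty family serves only to produce a stage, that is, `θ ≠ 0`.
  obtain ⟨t₀, -⟩ := h.exists_mem (fun _ => ∅) fun _ _ _ => disjoint_bot_left
  -- A common index: at every stage `t`, `k` is below the `b`-th term modulo the `t`-th ultrafilter.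
  obtain ⟨b, hb⟩ := (hp t₀).2.1 (Set.range a) (lt_succ_iff.2 (mk_range_le.trans (by simp)))
  obtain ⟨t, ht⟩ := h.exists_mem
    (fun t => {i | (∀ s : Set.Iio t, (p s).2.1 b i < k i) ∧ k i ≤ (p t).2.1 b i}) (by
      rw [pairwise_disjoint_on]
      intro s t hst
      refine Set.disjoint_left.2 fun i hs ht => ?_
      exact (ht.1 ⟨s, hst⟩).not_ge hs.2)
  obtain ⟨hD, -, hmono, -, hlt⟩ := hp t
  refine hD _ ht ?_
  filter_upwards [ha t, hmono _ _ (hb _ ⟨t, rfl⟩), hlt b, hD.le_dualFilter (hk' t)]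
    with i h₁ h₂ h₃ h₄
  exact ⟨fun s => (h₃ s).trans_le h₄, h₁.trans h₂⟩

theorem exists_mk_Iio_eq {μ ν : Cardinal.{u}} (h : ν < μ) :
    ∃ x : μ.ord.ToType, #(Set.Iio x) = ν := by
  obtain ⟨x, hx⟩ := Ordinal.typein_surj (· < · : μ.ord.ToType → μ.ord.ToType → Prop)
    (o := ν.ord) (by simpa using h)
  refine ⟨x, ?_⟩
  have := Ordinal.card_typein (r := (· < · : μ.ord.ToType → μ.ord.ToType → Prop)) x
  rw [hx, card_ord] at this
  exact this.symm

theorem tcf_le_cof_dualFilter {D : Ultrafilter ι} (hD : DisjointTo D I) :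
    tcf (ReducedProd lam (D : Filter ι)) ≤ cof (ReducedProd lam (dualFilter I)) := by
  obtain ⟨S, hS, hSc⟩ := exists_cof_eq (ReducedProd lam (dualFilter I))
  rw [← hSc]
  refine (tcf_le_cof (reducedProd_total D)).trans
    (cof_le (α := ReducedProd lam (D : Filter ι)) (s := S) fun f => ?_)
  obtain ⟨g, hg, hfg⟩ := hS f
  exact ⟨g, hg, hD.le_dualFilter hfg⟩

/-- Needed separately because `θ⁺`-directedness alone says too little when `θ` is finite. -/
theorem Admissible.aleph0_le_tcf (h : Admissible I lam θ) (D : Ultrafilter ι) :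
    ℵ₀ ≤ tcf (ReducedProd lam (D : Filter ι)) := by
  have := noMaxOrder_reducedProd h.isRegular (D : Filter ι)
  refine (hasTrueCofinality_tcf (reducedProd_total D)).le_of_isCardDirected fun A hA => ?_
  have : Finite A := lt_aleph0_iff_finite.1 hA
  obtain ⟨g, hg⟩ := exists_forall_le_of_finite h.isRegular
    (fun f : A => (f : ReducedProd lam (D : Filter ι)))
  exact ⟨g, fun f hf => Filter.Eventually.of_forall fun i => hg i ⟨f, hf⟩⟩

theorem Admissible.cof_le (h : Admissible I lam θ) {μ : Cardinal.{u}}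
    (hμ : IsGreatest (pcf I lam) μ) : cof (ReducedProd lam (dualFilter I)) ≤ μ := by
  classical
  have hinf : ℵ₀ ≤ μ := by
    obtain ⟨D, -, rfl⟩ := hμ.1
    exact h.aleph0_le_tcf D
  choose F hF using h.exists_universal_sequence
  -- Enumerates all cardinals `≤ μ` by `μ` indices: initial segments give those below `μ`, `none`
  -- gives `μ` itself.
  let ν : Option μ.ord.ToType → Cardinal.{u} := fun o => o.elim μ fun x => #(Set.Iio x)
  have hν (o) : ν o ≤ μ := by
    rcases o with _ | x
    · exact le_rfl
    · simpa [ν] using (mk_Iio_lt x (by simp)).le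
  let G : Set ((i : ι) → (lam i).ord.ToType) := ⋃ o, Set.range (F (ν o))
  have hG : #G ≤ μ := by
    refine (mk_iUnion_le _).trans ((mul_le_mul' ?_ (ciSup_le' fun o => ?_)).trans
      (mul_eq_self hinf).le)
    · rw [mk_option, mk_ord_toType]
      exact (add_one_eq hinf).le
    · exact mk_range_le.trans (by simpa using hν o)
  choose b hb using fun s : List G => exists_forall_le_of_finite h.isRegular
    (fun f : {f // f ∈ s} => (f : G).1)
  have hcof : IsCofinal (α := ReducedProd lam (dualFilter I)) (Set.range b) := by
    intro g
    by_contra! hno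
    obtain ⟨D, hD, hlt⟩ := exists_disjointTo_forall_mem (I := I)
      (fun f : G => {i | f.1 i < g i}) (by
        intro s hs
        refine hno _ ⟨s.toList, rfl⟩ (mem_dualFilter.2 (I.lower (fun i hi => ?_) hs))
        refine Set.mem_iInter₂.2 fun f hf => ?_
        exact (hb s.toList i ⟨f, Finset.mem_toList.2 hf⟩).trans_lt (not_le.1 hi))
    obtain ⟨o, ho⟩ : ∃ o, ν o = tcf (ReducedProd lam (D : Filter ι)) := by
      rcases (hμ.2 ⟨D, hD, rfl⟩ : tcf (ReducedProd lam (D : Filter ι)) ≤ μ).eq_or_lt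
        with heq | hlt
      · exact ⟨none, heq.symm⟩
      · obtain ⟨x, hx⟩ := exists_mk_Iio_eq hlt
        exact ⟨some x, hx⟩
    obtain ⟨a, ha⟩ := hF (ν o) D hD ho.symm g
    have hlt' : ∀ᶠ i in (D : Filter ι), F (ν o) a i < g i :=
      hlt ⟨F (ν o) a, Set.mem_iUnion.2 ⟨o, a, rfl⟩⟩
    obtain ⟨i, hi, hi'⟩ := (ha.and hlt').exists
    exact hi.not_gt hi'
  refine (Order.cof_le hcof).trans (mk_range_le.trans ((mk_list_le_max _).trans ?_))
  exact max_le hinf hG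

end

end PcfTheory

theorem fact2p10 {ι : Type u} (I : Order.Ideal (Set ι)) (hI : I.IsProper)
    (lam : ι → Cardinal.{u}) (θ : Cardinal.{u}) (h : PcfTheory.BasicAssumption I lam θ) :
    (∀ (c : Set Cardinal.{u}) (Bs : c → Set ι) (B : Set ι),
      PcfTheory.IsGeneratingSequence I lam c Bs → PcfTheory.pcfRestrict I lam B ⊆ c →
        ∃ d : Finset c, B \ (⋃ μ ∈ d, Bs μ) ∈ I) ∧
    IsGreatest (PcfTheory.pcf I lam)
      (Order.cof (PcfTheory.ReducedProd lam (PcfTheory.dualFilter I))) := by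
  have ha := h.admissible
  refine ⟨fun c Bs B hgen hB => ha.exists_finset_diff_mem hgen hB, ?_⟩
  obtain ⟨μ, hμ⟩ := ha.exists_isGreatest_pcf hI
  have hcof : Order.cof (PcfTheory.ReducedProd lam (PcfTheory.dualFilter I)) = μ := by
    refine (ha.cof_le hμ).antisymm ?_
    obtain ⟨D, hD, rfl⟩ := hμ.1
    exact PcfTheory.tcf_le_cof_dualFilter hD
  rwa [hcof]
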